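/- Let $c>0$ and let $\{x_j\}$ be a Poisson process on $\mathbb{R}$ with constant intensity $c$: the numbers of points in pairwise disjoint Borel sets $A_1,\dots,A_m$ of finite Lebesgue measure are independent and Poisson distributed with parameters $c|A_1|,\dots,c|A_m|$. Say that a random variable has Cauchy distribution if, for some scale $\gamma>0$, it has density $\frac{\gamma}{\pi(\gamma^2+y^2)}$ on $\mathbb{R}$. (a) The sum $\sum_j \frac1{x_j}$, understood in the sense of principal value, i.e. as $\lim_{R\to\infty}\sum_{|x_j|\le R}\frac1{x_j}$, exists almost surely and has Cauchy distribution. (b) Let $\xi_j$ be independent identically distributed real random variables with finite expectation which are not almost surely zero, and let the sequence $(\xi_j)$ be independent of the (enumerated) points $(x_j)$. Then the sum $\sum_j\frac{\xi_j}{x_j}=\lim_{R\to\infty}\sum_{|x_j|\le R}\frac{\xi_j}{x_j}$ exists almost surely and has Cauchy distribution. -/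

import Mathlib

open MeasureTheory ProbabilityTheory Filter Topology
open scoped NNReal ENNReal

/-- The number of points of the configuration `x = {x_j}` (counted with multiplicity) that lie
in the set `A`; the value `⊤` means that there are infinitely many of them. -/
noncomputable def pointCount {ι X : Type*} (x : ι → X) (A : Set X) : ℕ∞ :=
  {j : ι | x j ∈ A}.encard

/-- The random points `x_j`, listed in an arbitrary (random, measurable) order, form a Poisson
process with intensity measure `μ`: the number of points in a measurable set `A` of finite measure
has the Poisson distribution with parameter `μ A`, and the numbers of points in pairwise disjoint
such sets are independent. -/
structure IsPoissonProcess {Ω ι X : Type*} [MeasurableSpace Ω] [MeasurableSpace X]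
    (x : ι → Ω → X) (μ : Measure X) (P : Measure Ω) : Prop where
  measurable : ∀ j, Measurable (x j)
  hasLaw_count : ∀ A : Set X, MeasurableSet A → μ A ≠ ∞ →
    HasLaw (fun ω => pointCount (fun j => x j ω) A)
      ((poissonMeasure (μ A).toNNReal).map (Nat.cast : ℕ → ℕ∞)) P
  iIndepFun_count : ∀ (m : ℕ) (A : Fin m → Set X), (∀ i, MeasurableSet (A i)) →
    (∀ i, μ (A i) ≠ ∞) → Pairwise (fun i k => Disjoint (A i) (A k)) →
    iIndepFun (fun i ω => pointCount (fun j => x j ω) (A i)) P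

/-- The sum `∑_j a_j / x_j` exists in the sense of principal value and is equal to `s`: no `x_j`
vanishes, only finitely many `x_j` lie in each bounded interval, and the finite sums over the `j`
with `|x_j| ≤ R` converge to `s` as `R → ∞`. -/
def HasPrincipalValueSum {ι : Type*} (a x : ι → ℝ) (s : ℝ) : Prop :=
  (∀ j, x j ≠ 0) ∧ (∀ R : ℝ, {j | |x j| ≤ R}.Finite) ∧
    Tendsto (fun R : ℝ => ∑ᶠ j ∈ {j | |x j| ≤ R}, a j / x j) atTop (𝓝 s)

/-- The real random variable `S` has a (centred, nondegenerate) Cauchy distribution, that is, a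
law with density `γ / (π (γ² + y²))` for some scale `γ > 0`. -/
def HasCauchyDistribution {Ω : Type*} [MeasurableSpace Ω] (S : Ω → ℝ) (P : Measure Ω) : Prop :=
  ∃ γ : ℝ≥0, 0 < γ ∧ HasLaw S (cauchyMeasure 0 γ) P

/-! Part (a) is the case of marks equal to 1. For a Poisson process of intensity `μ`, `E ∏ g(x_j) =
exp ∫ (g - 1) dμ`: on a simple function this is independence plus the Poisson generating function,
and bounded approximation gives the rest. Independent marks are averaged out first, replacing `g(y,
m)` by its `ν`-mean. Hence the sum over `|x_j| ≤ n` has characteristic function `exp (c ∫_{|u| ≤ n}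
(E e^{itξ/u} - 1) du)`. The reflection `u ↦ -u` cancels the imaginary part; `1 - cos (tm/u)` is
integrable over the line, and the scaling `u = tm v` gives `|t| |m| ∫ (1 - cos v⁻¹) dv`. The limit
is `exp (-γ|t|)` with `γ = c E|ξ| ∫ (1 - cos v⁻¹) dv`, a Cauchy characteristic function
(`charFun_cauchyMeasure`).

For almost sure convergence, the line is cut into annuli `k - 1 < |u| ≤ k`, whose contributions are
independent (`iIndepFun_tsum`). Since the product of their characteristic functions has a nonzero
limit, the exponentials `exp (itS_n)`, divided by their means, form a bounded martingale and
converge. By Fubini this holds almost surely for almost every `t`, which forces `S_n` to converge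
(`exists_tendsto_of_ae_tendsto_exp`).

This treats integer radii. For real `R`, the error is at most a multiple of the sum of `|ξ_j|` over
one annulus divided by its radius. These sums are i.i.d. and integrable, so the strong law makes the
quotient vanish (`ae_tendsto_tsum_annulus_div`). -/

/-- The probability generating function of the Poisson distribution. -/
theorem integral_pow_poissonMeasure (r : ℝ≥0) (z : ℂ) :
    ∫ n : ℕ, z ^ n ∂(poissonMeasure r) = Complex.exp (r * (z - 1)) := by
  rw [integral_poissonMeasure]
  have h := (NormedSpace.expSeries_div_hasSum_exp (𝔸 := ℂ) ((r : ℂ) * z)).mul_left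
    (Complex.exp (-r))
  rw [← Complex.exp_eq_exp_ℂ, ← Complex.exp_add] at h
  rw [show (r : ℂ) * (z - 1) = -r + r * z by ring, ← h.tsum_eq]
  congr 1; ext n
  rw [Complex.real_smul]
  push_cast
  rw [mul_pow]
  ring

theorem tprod_mulIndicator_of_finite {ι X : Type*} {x : ι → X} {A : Set X}
    (h : {j | x j ∈ A}.Finite) (g : X → ℂ) :
    ∏' j, A.mulIndicator g (x j) = ∏ j ∈ h.toFinset, g (x j) := by
  rw [tprod_eq_prod (s := h.toFinset)]
  · refine Finset.prod_congr rfl fun j hj => Set.mulIndicator_of_mem (by simpa using hj) _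
  · exact fun j hj => Set.mulIndicator_of_notMem (by simpa using hj) _

theorem measurable_mulIndicator {X : Type*} [MeasurableSpace X] {A : Set X}
    (hA : MeasurableSet A) {g : X → ℂ} (hg : Measurable g) : Measurable (A.mulIndicator g) := by
  classical
  rw [← Set.piecewise_eq_mulIndicator]
  exact hg.piecewise hA measurable_const

/-! ### Generating functional and mean counts of a Poisson process -/

namespace IsPoissonProcess

variable {Ω ι X : Type*} [MeasurableSpace Ω] [MeasurableSpace X] {x : ι → Ω → X} {μ : Measure X}
  {P : Measure Ω}

theorem ae_finite (hx : IsPoissonProcess x μ P) {A : Set X} (hA : MeasurableSet A)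
    (hμ : μ A ≠ ∞) : ∀ᵐ ω ∂P, {j | x j ω ∈ A}.Finite := by
  have h := hx.hasLaw_count A hA hμ
  have h1 : ∀ᵐ n ∂((poissonMeasure (μ A).toNNReal).map (Nat.cast : ℕ → ℕ∞)), n ≠ ⊤ := by
    rw [ae_map_iff (by fun_prop) (by measurability)]
    simp
  rw [← h.map_eq] at h1
  filter_upwards [ae_of_ae_map h.aemeasurable h1] with ω hω
  simpa [pointCount, Set.encard_ne_top_iff] using hω

theorem integral_pow_ncard (hx : IsPoissonProcess x μ P) {A : Set X} (hA : MeasurableSet A)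
    (hμ : μ A ≠ ∞) (z : ℂ) :
    ∫ ω, z ^ (pointCount (fun j => x j ω) A).toNat ∂P = Complex.exp (μ.real A * (z - 1)) := by
  have h := hx.hasLaw_count A hA hμ
  have h2 := integral_map h.aemeasurable (f := fun n : ℕ∞ => z ^ n.toNat)
    (measurable_of_countable _).aestronglyMeasurable
  rw [← h2, h.map_eq, integral_map (by fun_prop) (measurable_of_countable _).aestronglyMeasurable]
  simp [integral_pow_poissonMeasure, Measure.real, ENNReal.toReal]

/-- The generating functional of a Poisson process at a simple function. -/
theorem integral_tprod_simpleFunc (hx : IsPoissonProcess x μ P) {A : Set X}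
    (hA : MeasurableSet A) (hμ : μ A ≠ ∞) (g : SimpleFunc X ℂ) :
    ∫ ω, ∏' j, A.mulIndicator g (x j ω) ∂P = Complex.exp (∫ y in A, (g y - 1) ∂μ) := by
  classical
  -- The finitely many values of `g` split `A` into disjoint level sets, whose counts are
  -- independent; a point in `B i` contributes the factor `e i`.
  let e := g.range.equivFin.symm
  let B : Fin g.range.card → Set X := fun i => A ∩ g ⁻¹' {(e i : ℂ)}
  have hB : ∀ i, MeasurableSet (B i) := fun i => hA.inter (g.measurableSet_fiber _)
  have hBμ : ∀ i, μ (B i) ≠ ∞ := fun i => measure_ne_top_of_subset Set.inter_subset_left hμ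
  have hBd : Pairwise (Function.onFun Disjoint B) := by
    intro i k hik
    refine Set.disjoint_left.2 fun y hy hy' => hik ?_
    have h1 : g y = e i := hy.2
    have h2 : g y = e k := hy'.2
    exact e.injective (Subtype.ext (h1.symm.trans h2))
  have hAB : A = ⋃ i, B i := by
    ext y
    simp only [B, Set.mem_iUnion, Set.mem_inter_iff]
    refine ⟨fun hy => ⟨e.symm ⟨g y, g.mem_range_self y⟩, hy, by simp⟩, fun ⟨i, hi⟩ => hi.1⟩
  have h1 : ∀ᵐ ω ∂P, ∏' j, A.mulIndicator g (x j ω) =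
      ∏ i, (e i : ℂ) ^ (pointCount (fun j => x j ω) (B i)).toNat := by
    filter_upwards [hx.ae_finite hA hμ] with ω hω
    rw [tprod_mulIndicator_of_finite hω,
      ← Finset.prod_fiberwise hω.toFinset
        (fun j => e.symm ⟨g (x j ω), g.mem_range_self (x j ω)⟩)]
    refine Finset.prod_congr rfl fun i _ => ?_
    rw [Finset.prod_eq_pow_card (b := (e i : ℂ))]
    · congr 1
      rw [pointCount, ← Set.ncard_def, ← Set.ncard_coe_finset]
      congr 1
      ext j
      have : e.symm ⟨g (x j ω), g.mem_range_self (x j ω)⟩ = i ↔ g (x j ω) = e i := by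
        rw [Equiv.symm_apply_eq, Subtype.ext_iff]
      simp [B, this]
    · intro j hj
      have := (Finset.mem_filter.1 hj).2
      rw [← this]; simp
  rw [integral_congr_ae h1]
  have h2 := (hx.iIndepFun_count _ B hB hBμ hBd).comp
    (fun i (n : ℕ∞) => (e i : ℂ) ^ n.toNat) (fun i => measurable_of_countable _)
  have h3 := h2.integral_fun_prod_eq_prod_integral (fun i =>
    ((measurable_of_countable _).comp_aemeasurable
      (hx.hasLaw_count _ (hB i) (hBμ i)).aemeasurable).aestronglyMeasurable)
  simp only [Function.comp_apply] at h3
  rw [h3, Finset.prod_congr rfl fun i _ => hx.integral_pow_ncard (hB i) (hBμ i) _,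
    ← Complex.exp_sum]
  congr 1
  have h4 : ∀ i, IntegrableOn (fun y => g y - 1) (B i) μ := by
    intro i
    refine IntegrableOn.congr_fun (f := fun _ => (e i : ℂ) - 1) ?_ ?_ (hB i)
    · exact integrableOn_const (hBμ i)
    · intro y hy
      have : g y = e i := hy.2
      simp [this]
  conv_rhs => rw [hAB]
  rw [integral_iUnion_fintype hB hBd h4]
  refine Finset.sum_congr rfl fun i _ => ?_
  rw [setIntegral_congr_fun (g := fun _ => (e i : ℂ) - 1) (hB i), setIntegral_const,
    Complex.real_smul]
  intro y hy
  have : g y = e i := hy.2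
  simp [this]

/-- The generating functional of a Poisson process. -/
theorem integral_tprod [IsFiniteMeasure P] [Countable ι] (hx : IsPoissonProcess x μ P) {A : Set X}
    (hA : MeasurableSet A) (hμ : μ A ≠ ∞) {g : X → ℂ} (hg : Measurable g) (hg1 : ∀ y, ‖g y‖ ≤ 1) :
    ∫ ω, ∏' j, A.mulIndicator g (x j ω) ∂P = Complex.exp (∫ y in A, (g y - 1) ∂μ) := by
  have h0 : (1 : ℂ) ∈ Metric.closedBall (0 : ℂ) 1 := by simp
  -- Approximants taken inside the closed unit ball keep every product over points bounded by 1, as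
  -- dominated convergence requires.
  let G := SimpleFunc.approxOn g hg (Metric.closedBall 0 1) 1 h0
  have hG1 : ∀ n y, ‖G n y‖ ≤ 1 := fun n y => by
    simpa using SimpleFunc.approxOn_mem hg h0 n y
  have hGt : ∀ y, Tendsto (fun n => G n y) atTop (𝓝 (g y)) := fun y =>
    SimpleFunc.tendsto_approxOn hg h0 (subset_closure (by simpa using hg1 y))
  have h1 : Tendsto (fun n => ∫ ω, ∏' j, A.mulIndicator (G n) (x j ω) ∂P) atTop
      (𝓝 (∫ ω, ∏' j, A.mulIndicator g (x j ω) ∂P)) := by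
    refine tendsto_integral_of_dominated_convergence (fun _ => 1) ?_ (integrable_const _) ?_ ?_
    · exact fun n => (Measurable.tprod fun j =>
        (measurable_mulIndicator hA (G n).measurable).comp
          (hx.measurable j)).aestronglyMeasurable
    · intro n
      filter_upwards [hx.ae_finite hA hμ] with ω hω
      rw [tprod_mulIndicator_of_finite hω, norm_prod]
      exact Finset.prod_le_one (fun _ _ => norm_nonneg _) fun _ _ => hG1 _ _
    · filter_upwards [hx.ae_finite hA hμ] with ω hω
      simp_rw [tprod_mulIndicator_of_finite hω]
      exact tendsto_finsetProd _ fun j _ => hGt _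
  have h2 : Tendsto (fun n => ∫ y in A, (G n y - 1) ∂μ) atTop (𝓝 (∫ y in A, (g y - 1) ∂μ)) := by
    refine tendsto_integral_of_dominated_convergence (fun _ => 2) ?_ ?_ ?_ ?_
    · exact fun n => ((G n).measurable.sub_const 1).aestronglyMeasurable
    · exact integrableOn_const hμ
    · refine fun n => ae_of_all _ fun y => ?_
      calc ‖G n y - 1‖ ≤ ‖G n y‖ + ‖(1 : ℂ)‖ := norm_sub_le _ _
        _ ≤ 2 := by have := hG1 n y; norm_num; linarith
    · exact ae_of_all _ fun y => (hGt y).sub_const 1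
  refine tendsto_nhds_unique h1 ?_
  simp_rw [hx.integral_tprod_simpleFunc hA hμ]
  exact (Complex.continuous_exp.tendsto _).comp h2

/-- A set of finite measure contains finitely many points in the mean. -/
theorem tsum_measure_ne_top [Countable ι] (hx : IsPoissonProcess x μ P) {A : Set X}
    (hA : MeasurableSet A) (hμ : μ A ≠ ∞) : ∑' j, P (x j ⁻¹' A) ≠ ∞ := by
  have h := hx.hasLaw_count A hA hμ
  have h1 : ∑' j, P (x j ⁻¹' A) =
      ∫⁻ ω, (pointCount (fun j => x j ω) A : ℝ≥0∞) ∂P := by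
    have : ∀ j, P (x j ⁻¹' A) = ∫⁻ ω, (x j ⁻¹' A).indicator 1 ω ∂P := fun j => by
      rw [lintegral_indicator_one (hx.measurable j hA)]
    simp_rw [this]
    rw [← lintegral_tsum fun j => (measurable_one.indicator (hx.measurable j hA)).aemeasurable]
    refine lintegral_congr fun ω => ?_
    rw [pointCount, ← ENNReal.tsum_set_one,
      tsum_subtype {j | x j ω ∈ A} (fun _ => (1 : ℝ≥0∞))]
    rfl
  have h2 := lintegral_map' (f := fun n : ℕ∞ => (n : ℝ≥0∞))
    (measurable_of_countable _).aemeasurable h.aemeasurable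
  rw [h1, ← h2, h.map_eq, lintegral_map (measurable_of_countable _) (by fun_prop)]
  have h3 : Integrable (fun n : ℕ => (n : ℝ)) (poissonMeasure (μ A).toNNReal) := by
    rw [integrable_poissonMeasure_iff, ← summable_nat_add_iff 1]
    have := (Real.summable_pow_div_factorial ((μ A).toNNReal : ℝ)).mul_left
      (Real.exp (-((μ A).toNNReal : ℝ)) * (μ A).toNNReal)
    refine this.congr fun n => ?_
    rw [Nat.factorial_succ, pow_succ]
    push_cast
    rw [Real.norm_of_nonneg (by positivity)]
    field_simp
  have h4 := h3.hasFiniteIntegral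
  rw [HasFiniteIntegral] at h4
  simpa [enorm_eq_nnnorm] using h4.ne

end IsPoissonProcess

/-! ### Independent marks -/

section Marks

variable {Ω ι X M : Type*} [MeasurableSpace Ω] [MeasurableSpace X] [MeasurableSpace M]
  {x : ι → Ω → X} {ξ : ι → Ω → M} {μ : Measure X} {ν : Measure M} {P : Measure Ω}
  [IsProbabilityMeasure P] [IsProbabilityMeasure ν]

/-- Independent marks may be averaged out of a finite product. -/
theorem integral_prod_marks (hx : ∀ j, Measurable (x j)) (hξ : ∀ j, Measurable (ξ j))
    (hν : ∀ j, P.map (ξ j) = ν) (hi : iIndepFun ξ P)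
    (hxξ : IndepFun (fun ω j => ξ j ω) (fun ω j => x j ω) P) {g : X × M → ℂ} (hg : Measurable g)
    (hg1 : ∀ p, ‖g p‖ ≤ 1) (s : Finset ι) :
    ∫ ω, ∏ j ∈ s, g (x j ω, ξ j ω) ∂P = ∫ ω, ∏ j ∈ s, ∫ m, g (x j ω, m) ∂ν ∂P := by
  have hxm : Measurable (fun ω j => x j ω) := measurable_pi_lambda _ hx
  have hξm : Measurable (fun ω j => ξ j ω) := measurable_pi_lambda _ hξ
  let F : (ι → M) × (ι → X) → ℂ := fun p => ∏ j ∈ s, g (p.2 j, p.1 j)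
  have hF : Measurable F := Finset.measurable_fun_prod _ fun j _ => hg.comp (by fun_prop)
  have hG : Measurable fun y => ∫ m, g (y, m) ∂ν :=
    (hg.stronglyMeasurable.integral_prod_right' (ν := ν)).measurable
  have hmap := (indepFun_iff_map_prod_eq_prod_map_map hξm.aemeasurable hxm.aemeasurable).1 hxξ
  have : IsProbabilityMeasure (P.map fun ω j => ξ j ω) :=
    Measure.isProbabilityMeasure_map hξm.aemeasurable
  have : IsProbabilityMeasure (P.map fun ω j => x j ω) :=
    Measure.isProbabilityMeasure_map hxm.aemeasurable
  have hFint : Integrable F ((P.map fun ω j => ξ j ω).prod (P.map fun ω j => x j ω)) := by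
    refine Integrable.of_bound hF.aestronglyMeasurable 1 (ae_of_all _ fun p => ?_)
    rw [norm_prod]
    exact Finset.prod_le_one (fun _ _ => norm_nonneg _) fun _ _ => hg1 _
  have h1 : ∫ ω, ∏ j ∈ s, g (x j ω, ξ j ω) ∂P =
      ∫ p, F p ∂((P.map fun ω j => ξ j ω).prod (P.map fun ω j => x j ω)) := by
    rw [← hmap, integral_map (hξm.prodMk hxm).aemeasurable hF.aestronglyMeasurable]
  -- By Fubini the positions can be frozen; the marks are then still independent with law `ν`.
  rw [h1, integral_prod_symm _ hFint]
  have h2 : ∀ y : ι → X, ∫ m, F (m, y) ∂(P.map fun ω j => ξ j ω) =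
      ∏ j ∈ s, ∫ m, g (y j, m) ∂ν := by
    intro y
    rw [integral_map hξm.aemeasurable
      (f := fun m => F (m, y)) (hF.comp measurable_prodMk_right).aestronglyMeasurable]
    have hm : ∀ j, Measurable fun m => g (y j, m) := fun j => hg.comp (by fun_prop)
    have h3 := ((hi.precomp (g := ((↑) : s → ι)) Subtype.val_injective).comp
      (fun j m => g (y j, m)) (fun j => hm j)).integral_fun_prod_eq_prod_integral
      (fun j => ((hm j).comp (hξ j)).aestronglyMeasurable)
    simp only [Function.comp_apply] at h3
    rw [← Finset.prod_coe_sort s fun j => ∫ m, g (y j, m) ∂ν]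
    simp only [F]
    simp_rw [← Finset.prod_coe_sort s]
    rw [h3]
    refine Finset.prod_congr rfl fun j _ => ?_
    rw [← hν j, integral_map (hξ j).aemeasurable (hm j).aestronglyMeasurable]
  simp_rw [h2]
  rw [integral_map hxm.aemeasurable]
  exact (Finset.measurable_fun_prod _ fun j _ =>
    hG.comp (measurable_pi_apply j)).aestronglyMeasurable

/-- The generating functional of an independently marked Poisson process. -/
theorem IsPoissonProcess.integral_tprod_marks [Countable ι] (hP : IsPoissonProcess x μ P)
    (hξ : ∀ j, Measurable (ξ j)) (hν : ∀ j, P.map (ξ j) = ν) (hi : iIndepFun ξ P)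
    (hxξ : IndepFun (fun ω j => ξ j ω) (fun ω j => x j ω) P)
    {A : Set X} (hA : MeasurableSet A) (hμ : μ A ≠ ∞) {g : X × M → ℂ} (hg : Measurable g)
    (hg1 : ∀ p, ‖g p‖ ≤ 1) (hgA : ∀ y ∉ A, ∀ m, g (y, m) = 1) :
    ∫ ω, ∏' j, g (x j ω, ξ j ω) ∂P = Complex.exp (∫ y in A, (∫ m, g (y, m) ∂ν - 1) ∂μ) := by
  have hG : Measurable fun y => ∫ m, g (y, m) ∂ν :=
    (hg.stronglyMeasurable.integral_prod_right' (ν := ν)).measurable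
  have hG1 : ∀ y, ‖∫ m, g (y, m) ∂ν‖ ≤ 1 := fun y => by
    simpa using norm_integral_le_of_norm_le_const (μ := ν) (ae_of_all _ fun m => hg1 (y, m))
  have hGA : A.mulIndicator (fun y => ∫ m, g (y, m) ∂ν) = fun y => ∫ m, g (y, m) ∂ν := by
    refine Set.mulIndicator_eq_self.2 fun y hy => by_contra fun h => hy ?_
    simp [hgA y h]
  rw [← hP.integral_tprod hA hμ hG hG1, hGA]
  -- Almost surely only finitely many factors differ from 1, so the finite products converge to the
  -- full one. This is applied to the marked and to the averaged product, whose finite versions have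
  -- equal integrals.
  have key : ∀ f : ι → Ω → ℂ, (∀ j, Measurable (f j)) → (∀ j ω, ‖f j ω‖ ≤ 1) →
      (∀ j ω, x j ω ∉ A → f j ω = 1) →
      Tendsto (fun s : Finset ι => ∫ ω, ∏ j ∈ s, f j ω ∂P) atTop (𝓝 (∫ ω, ∏' j, f j ω ∂P)) := by
    intro f hf hf1 hfA
    refine tendsto_integral_filter_of_dominated_convergence (fun _ => 1) ?_ ?_
      (integrable_const _) ?_
    · exact Eventually.of_forall fun s =>
        (Finset.measurable_fun_prod _ fun j _ => hf j).aestronglyMeasurable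
    · refine Eventually.of_forall fun s => ae_of_all _ fun ω => ?_
      rw [norm_prod]
      exact Finset.prod_le_one (fun _ _ => norm_nonneg _) fun _ _ => hf1 _ _
    · filter_upwards [hP.ae_finite hA hμ] with ω hω
      have hs : ({j | x j ω ∈ A} : Set ι).Finite := hω
      exact (multipliable_of_hasFiniteMulSupport (L := .unconditional ι)
        (hs.subset fun j hj => by_contra fun h => hj (hfA j ω h))).hasProd
  refine tendsto_nhds_unique
    (key _ (fun j => hg.comp ((hP.measurable j).prodMk (hξ j))) (fun j ω => hg1 _)
      (fun j ω h => hgA _ h _)) ?_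
  simp_rw [integral_prod_marks hP.measurable hξ hν hi hxξ hg hg1]
  refine key _ (fun j => hG.comp (hP.measurable j)) (fun j ω => hG1 _) (fun j ω h => ?_)
  simp [hgA _ h]

omit [IsProbabilityMeasure P] [IsProbabilityMeasure ν] in
/-- The marks of the points in a set of finite measure have an integrable sum. -/
theorem IsPoissonProcess.lintegral_tsum_marks_ne_top [Countable ι] (hP : IsPoissonProcess x μ P)
    (hξ : ∀ j, Measurable (ξ j)) (hν : ∀ j, P.map (ξ j) = ν)
    (hxξ : IndepFun (fun ω j => ξ j ω) (fun ω j => x j ω) P)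
    {A : Set X} (hA : MeasurableSet A) (hμ : μ A ≠ ∞) {f : M → ℝ≥0∞} (hf : Measurable f)
    (hfν : ∫⁻ m, f m ∂ν ≠ ∞) :
    ∫⁻ ω, ∑' j, A.indicator 1 (x j ω) * f (ξ j ω) ∂P ≠ ∞ := by
  have hA1 : Measurable (A.indicator (1 : X → ℝ≥0∞)) := measurable_one.indicator hA
  have hm : ∀ j, Measurable fun ω => A.indicator 1 (x j ω) * f (ξ j ω) := fun j =>
    (hA1.comp (hP.measurable j)).mul (hf.comp (hξ j))
  rw [lintegral_tsum fun j => (hm j).aemeasurable]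
  have h : ∀ j, ∫⁻ ω, A.indicator 1 (x j ω) * f (ξ j ω) ∂P =
      P (x j ⁻¹' A) * ∫⁻ m, f m ∂ν := by
    intro j
    have hj : IndepFun (A.indicator (1 : X → ℝ≥0∞) ∘ x j) (f ∘ ξ j) P :=
      (hxξ.comp (hf.comp (measurable_pi_apply j)) (hA1.comp (measurable_pi_apply j))).symm
    have := lintegral_mul_eq_lintegral_mul_lintegral_of_indepFun
      (hA1.comp (hP.measurable j)) (hf.comp (hξ j)) hj
    simp only [Pi.mul_apply, Function.comp_apply] at this
    rw [this, ← hν j, lintegral_map hf (hξ j), ← lintegral_indicator_one (hP.measurable j hA)]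
    rfl
  simp_rw [h]
  rw [ENNReal.tsum_mul_right]
  exact ENNReal.mul_ne_top (hP.tsum_measure_ne_top hA hμ) hfν

end Marks

/-! ### Cauchy characteristic function and the limiting exponent -/

section Analysis

open scoped FourierTransform

theorem integrable_exp_neg_mul_abs {a : ℝ} (ha : 0 < a) :
    Integrable fun v : ℝ => (Real.exp (-(a * |v|)) : ℂ) := by
  suffices h' : Integrable fun v : ℝ => Real.exp (-(a * |v|)) from h'.ofReal
  have h : IntegrableOn (fun v : ℝ => Real.exp (-(a * |v|))) (Set.Ioi 0) := by
    refine (exp_neg_integrableOn_Ioi 0 ha).congr_fun (fun v hv => ?_) measurableSet_Ioi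
    simp only [abs_of_pos (Set.mem_Ioi.1 hv), neg_mul]
  rw [← integrableOn_univ, ← Set.Iic_union_Ioi (a := (0 : ℝ)), integrableOn_union]
  refine ⟨?_, h⟩
  rw [integrableOn_Iic_iff_integrableOn_Iio]
  simpa using IntegrableOn.comp_neg (s := Set.Ioi (0 : ℝ)) h

/-- The Fourier transform of the two-sided exponential is the Cauchy density. -/
theorem fourier_exp_neg_mul_abs {γ : ℝ≥0} (hγ : 0 < γ) (w : ℝ) :
    𝓕 (fun v : ℝ => (Real.exp (-(2 * Real.pi * γ * |v|)) : ℂ)) w = cauchyPDFReal 0 γ w := by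
  have hγ' : (0 : ℝ) < γ := hγ
  have hπ := Real.pi_pos
  have hI : Integrable fun v : ℝ => Complex.exp (((-2 * Real.pi * inner ℝ v w : ℝ) : ℂ) * Complex.I) •
      (Real.exp (-(2 * Real.pi * γ * |v|)) : ℂ) := by
    refine (integrable_exp_neg_mul_abs (a := 2 * Real.pi * γ) (by positivity)).bdd_mul (c := 1) ?_ ?_
    · exact Continuous.aestronglyMeasurable (by fun_prop)
    · exact ae_of_all _ fun v => by rw [Complex.norm_exp_ofReal_mul_I]
  rw [Real.fourier_eq', ← intervalIntegral.integral_Iic_add_Ioi hI.integrableOn hI.integrableOn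
    (b := 0)]
  have h1 : ∫ v in Set.Iic (0 : ℝ), Complex.exp (((-2 * Real.pi * inner ℝ v w : ℝ) : ℂ) * Complex.I) •
      (Real.exp (-(2 * Real.pi * γ * |v|)) : ℂ) = 1 / (2 * Real.pi * (γ - w * Complex.I)) := by
    rw [setIntegral_congr_fun (g := fun v : ℝ =>
      Complex.exp ((2 * Real.pi * (γ - w * Complex.I)) * v)) measurableSet_Iic,
      integral_exp_mul_complex_Iic]
    · simp
    · simp; positivity
    · intro v hv
      simp only [smul_eq_mul]
      rw [abs_of_nonpos hv, Complex.ofReal_exp, ← Complex.exp_add]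
      congr 1
      simp
      ring
  have h2 : ∫ v in Set.Ioi (0 : ℝ), Complex.exp (((-2 * Real.pi * inner ℝ v w : ℝ) : ℂ) * Complex.I) •
      (Real.exp (-(2 * Real.pi * γ * |v|)) : ℂ) = 1 / (2 * Real.pi * (γ + w * Complex.I)) := by
    rw [setIntegral_congr_fun (g := fun v : ℝ =>
      Complex.exp ((-(2 * Real.pi * (γ + w * Complex.I))) * v)) measurableSet_Ioi,
      integral_exp_mul_complex_Ioi]
    · rw [neg_div_neg_eq]; simp
    · simp; positivity
    · intro v hv
      simp only [smul_eq_mul]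
      rw [abs_of_pos hv, Complex.ofReal_exp, ← Complex.exp_add]
      congr 1
      simp
      ring
  rw [h1, h2, cauchyPDFReal_def]
  have h3 : (γ - w * Complex.I : ℂ) ≠ 0 := fun h => by
    have := congrArg Complex.re h; simp at this; exact hγ.ne' this
  have h4 : (γ + w * Complex.I : ℂ) ≠ 0 := fun h => by
    have := congrArg Complex.re h; simp at this; exact hγ.ne' this
  have h5 : ((w - 0) ^ 2 + γ ^ 2 : ℂ) = (γ - w * Complex.I) * (γ + w * Complex.I) := by
    ring_nf; simp
  push_cast
  rw [h5]
  field_simp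
  ring

/-- The characteristic function of the centred Cauchy distribution. -/
theorem charFun_cauchyMeasure {γ : ℝ≥0} (hγ : 0 < γ) (t : ℝ) :
    charFun (cauchyMeasure 0 γ) t = Complex.exp (-(γ * |t| : ℝ)) := by
  let f : ℝ → ℂ := fun v => (Real.exp (-(2 * Real.pi * γ * |v|)) : ℂ)
  have hπ := Real.pi_pos
  have hγ' : (0 : ℝ) < γ := hγ
  have hF : 𝓕 f = fun w => (cauchyPDFReal 0 γ w : ℂ) := funext (fourier_exp_neg_mul_abs hγ)
  -- Fourier inversion turns the transform of the two-sided exponential around; the argument `t /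
  -- (2π)` converts to the normalisation of `charFun`.
  have h := congrFun (Continuous.fourierInv_fourier_eq (f := f) (by fun_prop)
    (integrable_exp_neg_mul_abs (by positivity))
    (by rw [hF]; exact (integrable_cauchyPDFReal 0).ofReal)) (t / (2 * Real.pi))
  rw [hF, Real.fourierInv_eq'] at h
  rw [charFun_apply_real, cauchyMeasure_of_scale_ne_zero 0 hγ.ne',
    integral_withDensity_eq_integral_toReal_smul (measurable_cauchyPDF 0 γ)
      (ae_of_all _ fun _ => ENNReal.ofReal_lt_top)]
  have h6 : f (t / (2 * Real.pi)) = Complex.exp (-(γ * |t| : ℝ)) := by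
    simp only [f]
    rw [abs_div, abs_of_pos (show 0 < 2 * Real.pi by positivity), Complex.ofReal_exp]
    congr 1
    push_cast
    field_simp
  rw [← h6, ← h]
  refine integral_congr_ae (ae_of_all _ fun w => ?_)
  simp only [cauchyPDF]
  rw [ENNReal.toReal_ofReal (cauchyPDF_pos 0 hγ.ne' w).le, Complex.real_smul, smul_eq_mul, mul_comm]
  congr 2
  simp
  field_simp

/-- The left side is at most `2`, and at most `u⁻² / 2` for `u ≠ 0`; multiplying by `1 + u²` gives
at most `5/2`, so `4` is ample. -/
theorem one_sub_cos_inv_le (u : ℝ) : 1 - Real.cos u⁻¹ ≤ 4 * (1 + u ^ 2)⁻¹ := by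
  rw [← div_eq_mul_inv, le_div_iff₀ (by positivity)]
  have h0 : 0 ≤ 1 - Real.cos u⁻¹ := by linarith [Real.cos_le_one u⁻¹]
  have h1 := Real.neg_one_le_cos u⁻¹
  rcases eq_or_ne u 0 with rfl | hu
  · simp
  · have h2 : (1 - Real.cos u⁻¹) * u ^ 2 ≤ u⁻¹ ^ 2 / 2 * u ^ 2 := by
      gcongr
      linarith [Real.one_sub_sq_div_two_le_cos (x := u⁻¹)]
    have h3 : u⁻¹ ^ 2 / 2 * u ^ 2 = 1 / 2 := by field_simp
    linarith

theorem integrable_one_sub_cos_inv : Integrable fun u : ℝ => 1 - Real.cos u⁻¹ := by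
  refine (integrable_inv_one_add_sq.const_mul 4).mono'
    (Measurable.aestronglyMeasurable (by fun_prop)) (ae_of_all _ fun u => ?_)
  rw [Real.norm_of_nonneg (by linarith [Real.cos_le_one u⁻¹])]
  exact one_sub_cos_inv_le u

/-- The integrand is nonnegative and does not vanish on `(1, 2)`. Positivity makes the Cauchy scale
nondegenerate. -/
theorem integral_one_sub_cos_inv_pos : 0 < ∫ u : ℝ, (1 - Real.cos u⁻¹) := by
  rw [integral_pos_iff_support_of_nonneg (fun u => by
    simpa using Real.cos_le_one u⁻¹) integrable_one_sub_cos_inv]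
  refine lt_of_lt_of_le ?_ (measure_mono (s := Set.Ioo (1 : ℝ) 2) fun u hu => ?_)
  · simp
  · have h1 : u⁻¹ < 1 := inv_lt_one_of_one_lt₀ hu.1
    have h2 : 0 < u⁻¹ := inv_pos.2 (by linarith [hu.1])
    have h3 := Real.cos_lt_cos_of_nonneg_of_le_pi_div_two le_rfl
      (by linarith [Real.pi_gt_three]) h2
    rw [Real.cos_zero] at h3
    exact (sub_pos.2 h3).ne'

theorem integrable_one_sub_cos_div (a : ℝ) : Integrable fun u : ℝ => 1 - Real.cos (a / u) := by
  rcases eq_or_ne a 0 with rfl | ha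
  · simp
  · have := (integrable_comp_mul_left_iff (fun u : ℝ => 1 - Real.cos u⁻¹) (inv_ne_zero ha)).2
      integrable_one_sub_cos_inv
    refine this.congr (ae_of_all _ fun u => ?_)
    simp [div_eq_mul_inv, mul_comm]

/-- The substitution `u = a v` has Jacobian `|a|`. This homogeneity is what makes the limit law
Cauchy. -/
theorem integral_one_sub_cos_div (a : ℝ) :
    ∫ u : ℝ, (1 - Real.cos (a / u)) = |a| * ∫ u : ℝ, (1 - Real.cos u⁻¹) := by
  rcases eq_or_ne a 0 with rfl | ha
  · simp
  · have := Measure.integral_comp_inv_mul_left (fun u : ℝ => 1 - Real.cos u⁻¹) a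
    rw [smul_eq_mul] at this
    rw [← this]
    refine integral_congr_ae (ae_of_all _ fun u => ?_)
    simp [div_eq_mul_inv, mul_comm]

/-- The function `1 - cos (t m / u)`, the real part of `1 - exp (i t m / u)`, is jointly integrable in
`(u, m)` if the marks are integrable. -/
theorem integrable_prod_one_sub_cos {ν : Measure ℝ} [IsProbabilityMeasure ν]
    (hν : Integrable (fun m : ℝ => m) ν) (t : ℝ) :
    Integrable (fun p : ℝ × ℝ => 1 - Real.cos (t * p.2 / p.1)) (volume.prod ν) := by
  rw [integrable_prod_iff' (Measurable.aestronglyMeasurable (by fun_prop))]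
  refine ⟨ae_of_all _ fun m => integrable_one_sub_cos_div (t * m), ?_⟩
  have : ∀ m, ∫ u : ℝ, ‖1 - Real.cos (t * m / u)‖ =
      |m| * (|t| * ∫ u : ℝ, (1 - Real.cos u⁻¹)) := fun m => by
    rw [← mul_assoc, mul_comm |m|, ← abs_mul, ← integral_one_sub_cos_div]
    refine integral_congr_ae (ae_of_all _ fun u => ?_)
    exact Real.norm_of_nonneg (by linarith [Real.cos_le_one (t * m / u)])
  simp_rw [this]
  exact hν.abs.mul_const _

theorem integral_integral_one_sub_cos {ν : Measure ℝ} [IsProbabilityMeasure ν]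
    (hν : Integrable (fun m : ℝ => m) ν) (t : ℝ) :
    ∫ u : ℝ, ∫ m, (1 - Real.cos (t * m / u)) ∂ν =
      |t| * ((∫ m, |m| ∂ν) * ∫ u : ℝ, (1 - Real.cos u⁻¹)) := by
  rw [integral_integral_swap (integrable_prod_one_sub_cos hν t)]
  simp_rw [integral_one_sub_cos_div, abs_mul]
  rw [integral_mul_const, integral_const_mul]
  ring

/-- The exponents of the characteristic functions of the partial sums converge. -/
theorem tendsto_integral_charFun_div {ν : Measure ℝ} [IsProbabilityMeasure ν]
    (hν : Integrable (fun m : ℝ => m) ν) (t : ℝ) :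
    Tendsto (fun n : ℕ => ∫ u in {u : ℝ | |u| ≤ n},
      (∫ m, Complex.exp ((t * (m / u) : ℝ) * Complex.I) ∂ν - 1)) atTop
      (𝓝 ((-(|t| * ((∫ m, |m| ∂ν) * ∫ u : ℝ, (1 - Real.cos u⁻¹))) : ℝ) : ℂ)) := by
  let D : ℝ → ℂ := fun u => ∫ m, Complex.exp ((t * (m / u) : ℝ) * Complex.I) ∂ν - 1
  let C : ℝ → ℝ := fun u => ∫ m, (1 - Real.cos (t * m / u)) ∂ν
  let B : ℕ → Set ℝ := fun n => {u : ℝ | |u| ≤ n}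
  have hBm : ∀ n, MeasurableSet (B n) := fun n => measurableSet_le (by fun_prop) measurable_const
  have hBI : ∀ n, B n = Set.Icc (-n : ℝ) n := fun n => by ext u; simp [B, abs_le]
  have hE : ∀ u, Integrable (fun m : ℝ => Complex.exp ((t * (m / u) : ℝ) * Complex.I)) ν := fun u =>
    Integrable.of_bound (Measurable.aestronglyMeasurable (by fun_prop)) 1
      (ae_of_all _ fun m => by rw [Complex.norm_exp_ofReal_mul_I])
  have hDre : ∀ u, (D u).re = -C u := fun u => by
    simp only [D, C, Complex.sub_re, Complex.one_re]
    rw [integral_sub (integrable_const _)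
      (Integrable.of_bound (Measurable.aestronglyMeasurable (by fun_prop)) 1
        (ae_of_all _ fun m => Real.abs_cos_le_one _))]
    have := Complex.reCLM.integral_comp_comm (hE u)
    simp only [Complex.reCLM_apply, Complex.exp_ofReal_mul_I_re] at this
    rw [← this]
    simp [mul_div_assoc]
  -- Conjugate symmetry makes the integral over the symmetric set `B n` real. Only this
  -- cancellation, not integrability of `D`, handles the imaginary part.
  have hDc : ∀ u, D (-u) = (starRingEnd ℂ) (D u) := fun u => by
    simp only [D, map_sub, map_one, ← integral_conj]
    congr 2
    ext m
    rw [← Complex.exp_conj]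
    congr 1
    simp [div_neg]
  have hDm : Measurable D := by
    have : StronglyMeasurable fun p : ℝ × ℝ => Complex.exp ((t * (p.2 / p.1) : ℝ) * Complex.I) :=
      Measurable.stronglyMeasurable (by fun_prop)
    exact (this.integral_prod_right' (ν := ν)).measurable.sub_const 1
  have hDb : ∀ u, ‖D u‖ ≤ 2 := fun u => by
    have : ‖∫ m, Complex.exp ((t * (m / u) : ℝ) * Complex.I) ∂ν‖ ≤ 1 := by
      simpa using norm_integral_le_of_norm_le_const (μ := ν) (C := 1)
        (ae_of_all _ fun m => (Complex.norm_exp_ofReal_mul_I (t * (m / u))).le)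
    refine (norm_sub_le _ _).trans ?_
    rw [norm_one]
    linarith
  have hDi : ∀ n, IntegrableOn D (B n) := fun n =>
    Measure.integrableOn_of_bounded (by rw [hBI]; simp) hDm.aestronglyMeasurable
      (ae_of_all _ hDb)
  have hint : ∀ n, ∫ u in B n, D u = ((-∫ u in B n, C u : ℝ) : ℂ) := fun n => by
    have h1 : ∫ u in B n, D u = (starRingEnd ℂ) (∫ u in B n, D u) := by
      rw [← integral_conj, ← integral_indicator (hBm n), ← integral_indicator (hBm n),
        ← integral_neg_eq_self]
      refine integral_congr_ae (ae_of_all _ fun u => ?_)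
      simp only [Set.indicator_apply, B, Set.mem_ofPred_eq, abs_neg, hDc]
    rw [← Complex.conj_eq_iff_re.1 h1.symm]
    congr 1
    have := Complex.reCLM.integral_comp_comm (hDi n)
    simp only [Complex.reCLM_apply] at this
    rw [← this, ← integral_neg]
    simp_rw [hDre]
  have hlim : Tendsto (fun n => ∫ u in B n, C u) atTop (𝓝 (∫ u, C u)) := by
    have hU : ⋃ n, B n = Set.univ :=
      Set.eq_univ_of_forall fun u => Set.mem_iUnion.2 (exists_nat_ge |u|)
    have := tendsto_setIntegral_of_monotone (f := C) (μ := volume) hBm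
      (fun n k hnk u hu => le_trans (b := (n : ℝ)) hu (by exact_mod_cast hnk))
      ((integrable_prod_one_sub_cos hν t).integral_prod_left.integrableOn)
    rwa [hU, setIntegral_univ] at this
  have hfin := (Complex.continuous_ofReal.tendsto _).comp hlim.neg
  rw [show ∫ u, C u = _ from integral_integral_one_sub_cos hν t] at hfin
  exact hfin.congr fun n => (hint n).symm

end Analysis

/-! ### Almost sure convergence of independent series -/

section Convergence

/-- A real sequence converges if its exponentials `exp (i t s_n)` do for almost every `t`. -/
theorem exists_tendsto_of_ae_tendsto_exp {s : ℕ → ℝ}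
    (h : ∀ᵐ t ∂(gaussianReal 0 1), ∃ z, Tendsto (fun n => Complex.exp ((t * s n : ℝ) * Complex.I))
      atTop (𝓝 z)) : ∃ a, Tendsto s atTop (𝓝 a) := by
  -- The limits `z` have modulus 1, so `exp (it(s_p - s_q))` tends to 1 for almost every `t`.
  -- Averaging over a Gaussian `t` gives `exp (-(s_p - s_q)² / 2) → 1`, whose logarithm yields the
  -- Cauchy property.
  have h1 : Tendsto (fun p : ℕ × ℕ => charFun (gaussianReal 0 1) (s p.1 - s p.2)) atTop (𝓝 1) := by
    have : (1 : ℂ) = ∫ _, 1 ∂(gaussianReal 0 1) := by simp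
    rw [this]
    simp_rw [charFun_apply_real]
    refine tendsto_integral_filter_of_dominated_convergence (fun _ => 1) ?_ ?_
      (integrable_const _) ?_
    · exact Eventually.of_forall fun p => Measurable.aestronglyMeasurable (by fun_prop)
    · refine Eventually.of_forall fun p => ae_of_all _ fun t => ?_
      rw [← Complex.ofReal_mul, Complex.norm_exp_ofReal_mul_I]
    · filter_upwards [h] with t ⟨z, hz⟩
      have hn : ‖z‖ = 1 := tendsto_nhds_unique hz.norm (by
        simp_rw [Complex.norm_exp_ofReal_mul_I]; exact tendsto_const_nhds)
      have hz0 : z ≠ 0 := norm_ne_zero_iff.1 (by rw [hn]; exact one_ne_zero)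
      rw [← prod_atTop_atTop_eq]
      have := (hz.comp tendsto_fst).div (hz.comp (tendsto_snd (f := (atTop : Filter ℕ)))) hz0
      rw [div_self hz0] at this
      refine this.congr fun p => ?_
      simp only [Pi.div_apply, Function.comp_apply]
      rw [← Complex.exp_sub]
      congr 1
      push_cast
      ring
  have h2 : Tendsto (fun p : ℕ × ℕ => (s p.1 - s p.2) ^ 2) atTop (𝓝 0) := by
    have h3 := (Real.continuousAt_log (x := ‖(1 : ℂ)‖) (by simp)).tendsto.comp h1.norm
    simp only [norm_one, Real.log_one] at h3
    have h4 := h3.const_mul (-2)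
    rw [mul_zero] at h4
    refine h4.congr fun p => ?_
    simp only [Function.comp_apply]
    rw [charFun_gaussianReal, Complex.norm_exp, Real.log_exp]
    rw [show ((s p.1 - s p.2 : ℝ) : ℂ) * (0 : ℝ) * Complex.I -
      ((1 : ℝ≥0) : ℝ) * ((s p.1 - s p.2 : ℝ) : ℂ) ^ 2 / 2 =
      ((-((s p.1 - s p.2) ^ 2 / 2) : ℝ) : ℂ) by push_cast; ring, Complex.ofReal_re]
    ring
  refine cauchySeq_tendsto_of_complete (cauchySeq_iff_tendsto_dist_atTop_0.2 ?_)
  have h5 := (Real.continuous_sqrt.tendsto 0).comp h2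
  rw [Real.sqrt_zero] at h5
  refine h5.congr fun p => ?_
  simp [Real.sqrt_sq_eq_abs, Real.dist_eq]

variable {Ω : Type*} [MeasurableSpace Ω] {P : Measure Ω} [IsProbabilityMeasure P]

/-- The normalised exponentials of sums of independent random variables converge, by the martingale
convergence theorem. -/
theorem ae_exists_tendsto_exp_sum {Y : ℕ → Ω → ℝ} (hY : ∀ n, Measurable (Y n)) (hi : iIndepFun Y P)
    (t : ℝ) {z : ℂ} (hz : z ≠ 0)
    (h : Tendsto (fun n => ∏ k ∈ Finset.range n, charFun (P.map (Y k)) t) atTop (𝓝 z)) :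
    ∀ᵐ ω ∂P, ∃ a, Tendsto
      (fun n => Complex.exp ((t * ∑ k ∈ Finset.range n, Y k ω : ℝ) * Complex.I)) atTop (𝓝 a) := by
  let φ : ℕ → ℂ := fun k => charFun (P.map (Y k)) t
  let E : ℕ → Ω → ℂ := fun k ω => Complex.exp ((t * Y k ω : ℝ) * Complex.I)
  let S : ℕ → Ω → ℂ := fun n ω => Complex.exp ((t * ∑ k ∈ Finset.range n, Y k ω : ℝ) * Complex.I)
  let p : ℕ → ℂ := fun n => ∏ k ∈ Finset.range n, φ k
  have hSsucc : ∀ n ω, S (n + 1) ω = S n ω * E n ω := fun n ω => by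
    simp only [S, E]
    rw [← Complex.exp_add, Finset.sum_range_succ]
    congr 1
    push_cast
    ring
  have hEm : ∀ n, Measurable (E n) := fun n => by fun_prop
  have hSm : ∀ n, Measurable (S n) := fun n => by fun_prop
  have hE1 : ∀ n ω, ‖E n ω‖ = 1 := fun n ω => Complex.norm_exp_ofReal_mul_I _
  have hS1 : ∀ n ω, ‖S n ω‖ = 1 := fun n ω => Complex.norm_exp_ofReal_mul_I _
  have hEint : ∀ n, ∫ ω, E n ω ∂P = φ n := fun n => by
    simp only [φ, E]
    rw [charFun_apply_real, integral_map (hY n).aemeasurable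
      (Measurable.aestronglyMeasurable (by fun_prop))]
    simp
  -- A vanishing factor would make all later products, hence the limit `z`, vanish.
  have hp0 : ∀ n, p n ≠ 0 := fun n hn => by
    refine hz (tendsto_nhds_unique h (tendsto_const_nhds.congr' ?_))
    filter_upwards [eventually_ge_atTop n] with m hm
    obtain ⟨k, hk, hk0⟩ := Finset.prod_eq_zero_iff.1 hn
    exact (Finset.prod_eq_zero (Finset.mem_range.2
      ((Finset.mem_range.1 hk).trans_le hm)) hk0).symm
  have hpinv : Tendsto (fun n => (p n)⁻¹) atTop (𝓝 z⁻¹) := h.inv₀ hz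
  obtain ⟨R, hR⟩ := hpinv.norm.bddAbove_range
  have hR' : ∀ n, ‖(p n)⁻¹‖ ≤ R := fun n => hR ⟨n, rfl⟩
  let M : ℕ → Ω → ℂ := fun n ω => S n ω * (p n)⁻¹
  have hMm : ∀ n, Measurable (M n) := fun n => (hSm n).mul_const _
  have hM1 : ∀ n ω, ‖M n ω‖ ≤ R := fun n ω => by
    simp only [M]; rw [norm_mul, hS1, one_mul]; exact hR' n
  have hMi : ∀ n, Integrable (M n) P := fun n =>
    Integrable.of_bound (hMm n).aestronglyMeasurable R (ae_of_all _ (hM1 n))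
  -- The strict bound `k < n` makes `Y n` independent of `𝓖 n`, while `S n` is still measurable for
  -- it.
  let 𝓖 : Filtration ℕ ‹MeasurableSpace Ω› :=
    { seq := fun n => ⨆ k, ⨆ (_ : k < n), MeasurableSpace.comap (Y k) inferInstance
      mono' := fun m n hmn => iSup₂_le fun k hk => le_iSup₂_of_le k (hk.trans_le hmn) le_rfl
      le' := fun n => iSup₂_le fun k _ => (hY k).comap_le }
  have hYG : ∀ n, ∀ k < n, Measurable[𝓖 n] (Y k) := fun n k hk =>
    (comap_measurable (Y k)).mono (le_iSup₂_of_le k hk le_rfl) le_rfl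
  have hSG : ∀ n, Measurable[𝓖 n] (S n) := fun n => by
    have hsum : Measurable[𝓖 n] fun ω => ∑ k ∈ Finset.range n, Y k ω :=
      Finset.measurable_fun_sum _ fun k hk => hYG n k (Finset.mem_range.1 hk)
    exact (by fun_prop : Measurable fun y : ℝ =>
      Complex.exp ((t * y : ℝ) * Complex.I)).comp hsum
  have hMG : ∀ n, Measurable[𝓖 n] (M n) := fun n => (hSG n).mul_const _
  have hind : ∀ n, Indep (𝓖 n) (MeasurableSpace.comap (Y n) inferInstance) P := fun n => by
    have := indep_iSup_of_disjoint (fun k => (hY k).comap_le) hi.iIndep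
      (S := Set.Iio n) (T := {n}) (by simp)
    rw [iSup_singleton] at this
    exact this
  have hset : ∀ n s, MeasurableSet[𝓖 n] s → ∫ ω in s, M n ω ∂P = ∫ ω in s, M (n + 1) ω ∂P := by
    intro n s hs
    have hs' : MeasurableSet s := 𝓖.le n s hs
    have hI : IndepFun (s.indicator (M n)) (E n) P := by
      refine indep_of_indep_of_le_left (indep_of_indep_of_le_right (hind n) ?_) ?_
      · exact Measurable.comap_le ((by fun_prop : Measurable fun y : ℝ =>
          Complex.exp ((t * y : ℝ) * Complex.I)).comp (comap_measurable (Y n)))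
      · exact Measurable.comap_le ((hMG n).indicator hs)
    have := hI.integral_fun_mul_eq_mul_integral
      ((hMm n).indicator hs').aestronglyMeasurable (hEm n).aestronglyMeasurable
    rw [hEint, integral_indicator hs'] at this
    have hφ : φ n ≠ 0 := fun h0 => hp0 (n + 1) (by simp [p, Finset.prod_range_succ, h0])
    rw [← mul_div_cancel_right₀ (∫ ω in s, M n ω ∂P) hφ, ← this, ← integral_div,
      ← integral_indicator hs']
    refine integral_congr_ae (ae_of_all _ fun ω => ?_)
    by_cases hω : ω ∈ s
    · simp only [Set.indicator_of_mem hω, M, hSsucc, p, Finset.prod_range_succ]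
      field_simp
    · simp [Set.indicator_of_notMem hω]
  -- The convergence theorem is for real martingales, so it is applied to the real and imaginary
  -- parts.
  have key : ∀ L : ℂ →L[ℝ] ℝ, ∀ᵐ ω ∂P, ∃ c, Tendsto (fun n => L (M n ω)) atTop (𝓝 c) := by
    intro L
    have hmart : Martingale (fun n ω => L (M n ω)) 𝓖 P := by
      refine martingale_of_setIntegral_eq_succ
        (fun n => (L.measurable.comp (hMG n)).stronglyMeasurable)
        (fun n => L.integrable_comp (hMi n)) fun n s hs => ?_
      rw [L.integral_comp_comm (hMi n).integrableOn, L.integral_comp_comm (hMi _).integrableOn,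
        hset n s hs]
    refine hmart.submartingale.exists_ae_tendsto_of_bdd (R := (‖L‖ * R).toNNReal) fun n => ?_
    refine (eLpNorm_le_of_ae_bound (C := ‖L‖ * R) (ae_of_all _ fun ω => ?_)).trans ?_
    · exact (L.le_opNorm _).trans (by gcongr; exact hM1 n ω)
    · simp [ENNReal.ofReal]
  filter_upwards [key Complex.reCLM, key Complex.imCLM] with ω ⟨a, ha⟩ ⟨b, hb⟩
  have h6 : Tendsto (fun n => M n ω) atTop (𝓝 (a + b * Complex.I)) := by
    refine (((Complex.continuous_ofReal.tendsto a).comp ha).add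
      (((Complex.continuous_ofReal.tendsto b).comp hb).mul_const Complex.I)).congr fun n => ?_
    exact Complex.re_add_im _
  refine ⟨_, (h6.mul h).congr fun n => ?_⟩
  exact inv_mul_cancel_right₀ (hp0 n) _

/-- A series of independent random variables converges almost surely if the product of the
characteristic functions converges to a function without zeros. -/
theorem ae_exists_tendsto_sum_of_charFun {Y : ℕ → Ω → ℝ} (hY : ∀ n, Measurable (Y n))
    (hi : iIndepFun Y P) (h : ∀ t, ∃ z : ℂ, z ≠ 0 ∧
      Tendsto (fun n => ∏ k ∈ Finset.range n, charFun (P.map (Y k)) t) atTop (𝓝 z)) :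
    ∀ᵐ ω ∂P, ∃ a, Tendsto (fun n => ∑ k ∈ Finset.range n, Y k ω) atTop (𝓝 a) := by
  have h1 : ∀ᵐ t ∂(gaussianReal 0 1), ∀ᵐ ω ∂P, ∃ a, Tendsto
      (fun n => Complex.exp ((t * ∑ k ∈ Finset.range n, Y k ω : ℝ) * Complex.I)) atTop (𝓝 a) :=
    ae_of_all _ fun t => by
      obtain ⟨z, hz, hz'⟩ := h t
      exact ae_exists_tendsto_exp_sum hY hi t hz hz'
  -- Fubini replaces an exceptional null set for each `t` by a single one, outside which almost
  -- every `t` is good.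
  rw [Measure.ae_ae_comm (measurableSet_exists_tendsto fun n => by fun_prop)] at h1
  filter_upwards [h1] with ω hω
  exact exists_tendsto_of_ae_tendsto_exp hω

/-- The limit law of an almost surely convergent sequence is determined by the limits of the
characteristic functions. -/
theorem hasLaw_of_tendsto_charFun {S : ℕ → Ω → ℝ} {T : Ω → ℝ} (hS : ∀ n, Measurable (S n))
    (h : ∀ᵐ ω ∂P, Tendsto (fun n => S n ω) atTop (𝓝 (T ω))) {ν : Measure ℝ} [IsProbabilityMeasure ν]
    (hν : ∀ t, Tendsto (fun n => charFun (P.map (S n)) t) atTop (𝓝 (charFun ν t))) :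
    HasLaw T ν P := by
  have hT : AEMeasurable T P := aemeasurable_of_tendsto_metrizable_ae atTop
    (fun n => (hS n).aemeasurable) h
  refine ⟨hT, ?_⟩
  have := Measure.isProbabilityMeasure_map hT
  refine Measure.ext_of_charFun (funext fun t => tendsto_nhds_unique ?_ (hν t))
  simp_rw [charFun_apply_real]
  rw [integral_map hT (Measurable.aestronglyMeasurable (by fun_prop))]
  refine Tendsto.congr (fun n => (integral_map (hS n).aemeasurable
    (Measurable.aestronglyMeasurable (by fun_prop))).symm) ?_
  refine tendsto_integral_of_dominated_convergence (fun _ => 1) (fun n => ?_)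
    (integrable_const _) (fun n => ae_of_all _ fun ω => ?_) ?_
  · exact Measurable.aestronglyMeasurable (by fun_prop)
  · rw [← Complex.ofReal_mul, Complex.norm_exp_ofReal_mul_I]
  · filter_upwards [h] with ω hω
    exact ((by fun_prop : Continuous fun y : ℝ => Complex.exp (t * y * Complex.I)).tendsto _).comp hω

end Convergence

/-! ### Sums over a marked Poisson process -/

section ShotNoise

variable {Ω ι X M : Type*} [MeasurableSpace Ω] [MeasurableSpace X] [MeasurableSpace M]
  {x : ι → Ω → X} {ξ : ι → Ω → M} {μ : Measure X} {ν : Measure M} {P : Measure Ω}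
  [IsProbabilityMeasure P] [IsProbabilityMeasure ν] [Countable ι]

omit [MeasurableSpace M] [IsProbabilityMeasure P] [Countable ι] in
/-- A sum over the points in a set of finite measure has finitely many terms. -/
theorem IsPoissonProcess.ae_finite_support (hP : IsPoissonProcess x μ P) {A : Set X}
    (hA : MeasurableSet A) (hμ : μ A ≠ ∞) {w : X × M → ℝ} (hwA : ∀ y ∉ A, ∀ m, w (y, m) = 0) :
    ∀ᵐ ω ∂P, (Function.support fun j => w (x j ω, ξ j ω)).Finite := by
  filter_upwards [hP.ae_finite hA hμ] with ω hω
  exact Set.Finite.subset hω fun j hj => by_contra fun h => hj (hwA _ h _)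

/-- Campbell's formula for the characteristic function of a sum over a marked Poisson process. -/
theorem IsPoissonProcess.integral_exp_tsum (hP : IsPoissonProcess x μ P)
    (hξ : ∀ j, Measurable (ξ j)) (hν : ∀ j, P.map (ξ j) = ν) (hi : iIndepFun ξ P)
    (hxξ : IndepFun (fun ω j => ξ j ω) (fun ω j => x j ω) P)
    {A : Set X} (hA : MeasurableSet A) (hμ : μ A ≠ ∞) {w : X × M → ℝ} (hw : Measurable w)
    (hwA : ∀ y ∉ A, ∀ m, w (y, m) = 0) :
    ∫ ω, Complex.exp ((∑' j, w (x j ω, ξ j ω) : ℝ) * Complex.I) ∂P =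
      Complex.exp (∫ y in A, (∫ m, Complex.exp (w (y, m) * Complex.I) ∂ν - 1) ∂μ) := by
  rw [← hP.integral_tprod_marks (g := fun p => Complex.exp (w p * Complex.I)) hξ hν hi hxξ hA hμ
    (by fun_prop) (fun p => (Complex.norm_exp_ofReal_mul_I _).le) (fun y hy m => by simp [hwA y hy])]
  refine integral_congr_ae ?_
  filter_upwards [hP.ae_finite_support (ξ := ξ) hA hμ hwA] with ω hω
  have h1 : HasSum (fun j => w (x j ω, ξ j ω)) _ :=
    (summable_of_hasFiniteSupport (L := .unconditional ι) hω).hasSum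
  have h2 := ((Complex.hasSum_ofReal.2 h1).mul_right Complex.I).cexp
  exact h2.tprod_eq.symm

theorem IsPoissonProcess.charFun_tsum (hP : IsPoissonProcess x μ P)
    (hξ : ∀ j, Measurable (ξ j)) (hν : ∀ j, P.map (ξ j) = ν) (hi : iIndepFun ξ P)
    (hxξ : IndepFun (fun ω j => ξ j ω) (fun ω j => x j ω) P)
    {A : Set X} (hA : MeasurableSet A) (hμ : μ A ≠ ∞) {w : X × M → ℝ} (hw : Measurable w)
    (hwA : ∀ y ∉ A, ∀ m, w (y, m) = 0) (t : ℝ) :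
    charFun (P.map fun ω => ∑' j, w (x j ω, ξ j ω)) t =
      Complex.exp (∫ y in A, (∫ m, Complex.exp ((t * w (y, m) : ℝ) * Complex.I) ∂ν - 1) ∂μ) := by
  rw [← hP.integral_exp_tsum hξ hν hi hxξ hA hμ (w := fun p => t * w p) (hw.const_mul t)
    (fun y hy m => by simp [hwA y hy]), charFun_apply_real, integral_map]
  · simp_rw [tsum_mul_left]
    push_cast
    rfl
  · exact (Measurable.tsum fun j => hw.comp ((hP.measurable j).prodMk (hξ j))).aemeasurable
  · exact Measurable.aestronglyMeasurable (by fun_prop)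

/-- Sums over the points of a marked Poisson process in disjoint sets are independent. -/
theorem IsPoissonProcess.iIndepFun_tsum_fintype {κ : Type*} [Fintype κ]
    (hP : IsPoissonProcess x μ P)
    (hξ : ∀ j, Measurable (ξ j)) (hν : ∀ j, P.map (ξ j) = ν) (hi : iIndepFun ξ P)
    (hxξ : IndepFun (fun ω j => ξ j ω) (fun ω j => x j ω) P)
    {A : κ → Set X} (hA : ∀ k, MeasurableSet (A k)) (hμ : ∀ k, μ (A k) ≠ ∞)
    (hAd : Pairwise (Function.onFun Disjoint A)) {w : κ → X × M → ℝ} (hw : ∀ k, Measurable (w k))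
    (hwA : ∀ k, ∀ y ∉ A k, ∀ m, w k (y, m) = 0) :
    iIndepFun (fun k ω => ∑' j, w k (x j ω, ξ j ω)) P := by
  have hYm : ∀ k, Measurable fun ω => ∑' j, w k (x j ω, ξ j ω) := fun k =>
    Measurable.tsum fun j => (hw k).comp ((hP.measurable j).prodMk (hξ j))
  -- Independence is read off from factorisation of the joint characteristic function: on `A k` only
  -- the `k`-th term of `∑ t i * w i` survives, so the exponent splits over the disjoint sets.
  rw [iIndepFun_iff_charFun_pi fun k => (hYm k).aemeasurable]
  intro t
  have hU : MeasurableSet (⋃ k, A k) := MeasurableSet.iUnion hA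
  have hUμ : μ (⋃ k, A k) ≠ ∞ :=
    ((measure_iUnion_le _).trans_lt (by
      rw [tsum_fintype]; exact ENNReal.sum_lt_top.2 fun k _ => (hμ k).lt_top)).ne
  have h1 := hP.integral_exp_tsum hξ hν hi hxξ hU hUμ (w := fun p => ∑ k, t k * w k p)
    (Finset.measurable_fun_sum _ fun k _ => (hw k).const_mul _) (fun y hy m => by
      refine Finset.sum_eq_zero fun k _ => ?_
      rw [hwA k y (fun h => hy (Set.mem_iUnion.2 ⟨k, h⟩)), mul_zero])
  have h2 : charFun (P.map fun ω => WithLp.toLp 2 fun k => ∑' j, w k (x j ω, ξ j ω)) t =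
      ∫ ω, Complex.exp ((∑' j, ∑ k, t k * w k (x j ω, ξ j ω) : ℝ) * Complex.I) ∂P := by
    rw [charFun_apply, integral_map]
    · have hfin : ∀ᵐ ω ∂P, ∀ k, (Function.support fun j => w k (x j ω, ξ j ω)).Finite :=
        ae_all_iff.2 fun k => hP.ae_finite_support (hA k) (hμ k) (hwA k)
      refine integral_congr_ae ?_
      filter_upwards [hfin] with ω hω
      rw [Summable.tsum_finsetSum]
      · simp [PiLp.inner_apply, tsum_mul_left]
      · exact fun k _ => (summable_of_hasFiniteSupport (L := .unconditional ι) (hω k)).mul_left _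
    · exact ((WithLp.measurable_toLp 2 _).comp (measurable_pi_lambda _ hYm)).aemeasurable
    · exact Measurable.aestronglyMeasurable (by fun_prop)
  have hint : ∀ k, IntegrableOn (fun y =>
      (∫ m, Complex.exp ((∑ i, t i * w i (y, m) : ℝ) * Complex.I) ∂ν - 1)) (A k) μ := by
    intro k
    have hm : StronglyMeasurable fun p : X × M =>
        Complex.exp ((∑ i, t i * w i p : ℝ) * Complex.I) :=
      Measurable.stronglyMeasurable (by fun_prop)
    refine Measure.integrableOn_of_bounded (M := 2) (hμ k)
      ((hm.integral_prod_right' (ν := ν)).measurable.sub_const 1).aestronglyMeasurable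
      (ae_of_all _ fun y => (norm_sub_le _ _).trans ?_)
    have : ‖∫ m, Complex.exp ((∑ i, t i * w i (y, m) : ℝ) * Complex.I) ∂ν‖ ≤ 1 := by
      simpa using norm_integral_le_of_norm_le_const (μ := ν) (C := 1)
        (ae_of_all _ fun m => (Complex.norm_exp_ofReal_mul_I (∑ i, t i * w i (y, m))).le)
    rw [norm_one]
    linarith
  rw [h2, h1, integral_iUnion_fintype hA hAd hint, Complex.exp_sum]
  refine Finset.prod_congr rfl fun k _ => ?_
  rw [hP.charFun_tsum hξ hν hi hxξ (hA k) (hμ k) (hw k) (hwA k)]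
  congr 1
  refine setIntegral_congr_fun (hA k) fun y hy => ?_
  simp only
  congr 2
  ext m
  rw [Finset.sum_eq_single k (fun i _ hik => ?_) (by simp)]
  rw [hwA i y (fun h => Set.disjoint_left.1 (hAd hik) h hy), mul_zero]

theorem IsPoissonProcess.iIndepFun_tsum {κ : Type*}
    (hP : IsPoissonProcess x μ P)
    (hξ : ∀ j, Measurable (ξ j)) (hν : ∀ j, P.map (ξ j) = ν) (hi : iIndepFun ξ P)
    (hxξ : IndepFun (fun ω j => ξ j ω) (fun ω j => x j ω) P)
    {A : κ → Set X} (hA : ∀ k, MeasurableSet (A k)) (hμ : ∀ k, μ (A k) ≠ ∞)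
    (hAd : Pairwise (Function.onFun Disjoint A)) {w : κ → X × M → ℝ} (hw : ∀ k, Measurable (w k))
    (hwA : ∀ k, ∀ y ∉ A k, ∀ m, w k (y, m) = 0) :
    iIndepFun (fun k ω => ∑' j, w k (x j ω, ξ j ω)) P :=
  iIndepFun_iff_finset.2 fun s => hP.iIndepFun_tsum_fintype (κ := s) hξ hν hi hxξ
    (fun k => hA k) (fun k => hμ k) (fun _ _ h => hAd (Subtype.coe_injective.ne h))
    (fun k => hw k) (fun k => hwA k)

end ShotNoise

/-! ### Null sets, annuli and principal values -/

/-- The enumeration of a Poisson process avoids the null sets of the intensity. -/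
theorem IsPoissonProcess.ae_notMem {Ω ι X : Type*} [MeasurableSpace Ω] [MeasurableSpace X]
    {x : ι → Ω → X} {μ : Measure X} {P : Measure Ω} (hP : IsPoissonProcess x μ P) {A : Set X}
    (hA : MeasurableSet A) (hμ : μ A = 0) : ∀ᵐ ω ∂P, ∀ j, x j ω ∉ A := by
  have h := hP.hasLaw_count A hA (by simp [hμ])
  have h1 : ∀ᵐ n ∂((poissonMeasure (μ A).toNNReal).map (Nat.cast : ℕ → ℕ∞)), n = 0 := by
    rw [ae_map_iff (by fun_prop) (by measurability), ae_iff_of_countable]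
    intro n hn
    rw [poissonMeasure_singleton] at hn
    by_contra h0
    simp at h0
    simp [hμ, h0] at hn
  rw [← h.map_eq] at h1
  filter_upwards [ae_of_ae_map h.aemeasurable h1] with ω hω j hj
  have : {j | x j ω ∈ A} = ∅ := by simpa [pointCount] using hω
  exact (this ▸ hj : j ∈ (∅ : Set ι))

/-- A Poisson process with nonzero intensity has at least one index. -/
theorem IsPoissonProcess.nonempty {Ω ι X : Type*} [MeasurableSpace Ω] [MeasurableSpace X]
    {x : ι → Ω → X} {μ : Measure X} {P : Measure Ω} [IsProbabilityMeasure P]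
    (hP : IsPoissonProcess x μ P) {A : Set X}
    (hA : MeasurableSet A) (hμ : μ A ≠ 0) (hμ' : μ A ≠ ∞) : Nonempty ι := by
  by_contra h
  rw [not_nonempty_iff] at h
  -- At `z = 0` the generating function is the void probability `exp (-μ A)`. With no index it would
  -- equal 1, as `0 ^ 0 = 1`.
  have h1 := hP.integral_pow_ncard hA hμ' 0
  have h2 : ∀ ω, pointCount (fun j => x j ω) A = 0 := fun ω => by
    simp [pointCount, Set.eq_empty_of_isEmpty]
  simp only [h2] at h1
  have h3 := congrArg norm h1
  rw [Complex.norm_exp] at h3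
  have h4 : Real.exp (-(μ A).toReal) = 1 := by simpa [Measure.real] using h3.symm
  rw [Real.exp_eq_one_iff, neg_eq_zero, ENNReal.toReal_eq_zero_iff] at h4
  exact h4.elim hμ hμ'

/-- The set of the reals with `k - 1 < |u| ≤ k`. -/
def annulus (k : ℕ) : Set ℝ := {u | ⌈|u|⌉₊ = k}

theorem measurableSet_annulus (k : ℕ) : MeasurableSet (annulus k) :=
  (Nat.measurable_ceil.comp measurable_norm) (measurableSet_singleton k)

theorem pairwise_disjoint_annulus : Pairwise (Function.onFun Disjoint annulus) :=
  fun _ _ h => Set.disjoint_left.2 fun _ hu hu' => h (Eq.trans (Eq.symm hu) hu')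

theorem biUnion_annulus (n : ℕ) : ⋃ k ∈ Finset.range (n + 1), annulus k = {u : ℝ | |u| ≤ n} := by
  ext u
  simp [annulus, Nat.ceil_le]

theorem volume_annulus_zero : volume (annulus 0) = 0 := by
  have : annulus 0 = {0} := by ext u; simp [annulus]
  simp [this]

theorem volume_annulus_succ (k : ℕ) : volume (annulus (k + 1)) = 2 := by
  have h : annulus (k + 1) = Set.Icc (-(k + 1 : ℝ)) (k + 1) \ Set.Icc (-k : ℝ) k := by
    ext u
    simp only [annulus, Set.mem_ofPred_eq, Set.mem_sdiff, Set.mem_Icc, ← abs_le, not_le,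
      Nat.ceil_eq_iff (Nat.succ_ne_zero k)]
    push_cast
    rw [and_comm]
  rw [h, measure_sdiff (Set.Icc_subset_Icc (by linarith) (by linarith))
    measurableSet_Icc.nullMeasurableSet (by simp), Real.volume_Icc, Real.volume_Icc,
    ← ENNReal.ofReal_sub _ (by linarith [k.cast_nonneg (α := ℝ)])]
  ring_nf
  simp

theorem volume_annulus_ne_top (k : ℕ) : volume (annulus k) ≠ ∞ := by
  cases k with
  | zero => simp [volume_annulus_zero]
  | succ k => simp [volume_annulus_succ]

/-- Convergence along the integers and small sums over annuli give a principal value. -/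
theorem hasPrincipalValueSum_of_tendsto {ι : Type*} {a x : ι → ℝ} {s : ℝ} (hx : ∀ j, x j ≠ 0)
    (hfin : ∀ k, {j | x j ∈ annulus k}.Finite)
    (hs : Tendsto (fun n => ∑ k ∈ Finset.range n, ∑' j, (annulus k).indicator (fun _ => a j / x j) (x j))
      atTop (𝓝 s))
    (hz : Tendsto (fun n : ℕ => (∑' j, (annulus (n + 1)).indicator (fun _ => |a j|) (x j)) / (n + 1))
      atTop (𝓝 0)) : HasPrincipalValueSum a x s := by
  have hnat : ∀ n : ℕ, {j | |x j| ≤ n}.Finite := fun n => by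
    have : {j | |x j| ≤ n} = ⋃ k ∈ Finset.range (n + 1), {j | x j ∈ annulus k} := by
      ext j
      simpa using (Set.ext_iff.1 (biUnion_annulus n) (x j)).symm
    rw [this]
    exact Set.Finite.biUnion (Finset.finite_toSet _) fun k _ => hfin k
  have hR : ∀ R : ℝ, {j | |x j| ≤ R}.Finite := fun R =>
    (hnat ⌈R⌉₊).subset fun j hj => le_trans (b := R) hj (Nat.le_ceil R)
  refine ⟨hx, hR, ?_⟩
  have htsum : ∀ k (b : ι → ℝ), ∑' j, (annulus k).indicator (fun _ => b j) (x j) =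
      ∑ j ∈ (hfin k).toFinset, b j := fun k b => by
    rw [tsum_eq_sum (s := (hfin k).toFinset)]
    · exact Finset.sum_congr rfl fun j hj => Set.indicator_of_mem (by simpa using hj) _
    · exact fun j hj => Set.indicator_of_notMem (by simpa using hj) _
  simp_rw [htsum] at hs hz
  have hsum : ∀ n : ℕ, ∑ k ∈ Finset.range (n + 1), ∑ j ∈ (hfin k).toFinset, a j / x j =
      ∑ j ∈ (hnat n).toFinset, a j / x j := fun n => by
    rw [← Finset.sum_fiberwise_of_maps_to (g := fun j => ⌈|x j|⌉₊) (t := Finset.range (n + 1))]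
    · refine Finset.sum_congr rfl fun k hk => Finset.sum_congr ?_ fun _ _ => rfl
      ext j
      simp only [Set.Finite.mem_toFinset, annulus, Set.mem_ofPred_eq, Finset.mem_filter]
      refine ⟨fun h => ⟨Nat.ceil_le.1 ?_, h⟩, fun h => h.2⟩
      rw [h]; exact Nat.lt_succ_iff.1 (Finset.mem_range.1 hk)
    · intro j hj
      simpa [Nat.lt_succ_iff, Nat.ceil_le] using hj
  have h1 : Tendsto (fun R : ℝ => ∑ j ∈ (hnat ⌊R⌋₊).toFinset, a j / x j) atTop (𝓝 s) :=
    (((tendsto_add_atTop_iff_nat 1).2 hs).congr hsum).comp tendsto_nat_floor_atTop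
  have h2 : Tendsto (fun R : ℝ => ∑ᶠ j ∈ {j | |x j| ≤ R}, a j / x j -
      ∑ j ∈ (hnat ⌊R⌋₊).toFinset, a j / x j) atTop (𝓝 0) := by
    -- With `n = ⌊R⌋ ≥ 1`, the extra points satisfy `n < |x_j| ≤ R < n + 1`, so they lie in annulus
    -- `n + 1` and `1 / |x_j| ≤ 1 / n ≤ 2 / (n + 1)`.
    have hz' := (hz.const_mul 2).comp (tendsto_nat_floor_atTop (α := ℝ))
    rw [mul_zero] at hz'
    refine squeeze_zero_norm' ?_ hz'
    filter_upwards [eventually_ge_atTop 1] with R hR1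
    have hn1 : 1 ≤ ⌊R⌋₊ := (Nat.one_le_floor_iff R).2 hR1
    have hn : ((⌊R⌋₊ : ℕ) : ℝ) ≤ R := Nat.floor_le (by linarith)
    have hn' : R < ⌊R⌋₊ + 1 := Nat.lt_floor_add_one R
    have hn1' : (1 : ℝ) ≤ (⌊R⌋₊ : ℕ) := by exact_mod_cast hn1
    have hsub : (hnat ⌊R⌋₊).toFinset ⊆ (hR R).toFinset := by
      intro j hj
      simp only [Set.Finite.mem_toFinset, Set.mem_ofPred_eq] at hj ⊢
      exact hj.trans hn
    have hf := finsum_mem_eq_finite_toFinset_sum (fun j => a j / x j) (hR R)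
    simp only [Set.mem_ofPred_eq] at hf
    classical
    rw [hf, ← Finset.sum_sdiff hsub, add_sub_cancel_right]
    have hsub2 : (hR R).toFinset \ (hnat ⌊R⌋₊).toFinset ⊆ (hfin (⌊R⌋₊ + 1)).toFinset := by
      intro j hj
      simp only [Set.Finite.mem_toFinset, Set.mem_ofPred_eq, Finset.mem_sdiff, annulus,
        not_le] at hj ⊢
      rw [Nat.ceil_eq_iff (Nat.succ_ne_zero _)]
      push_cast
      exact ⟨by simpa using hj.2, by linarith [hj.1]⟩
    simp only [Function.comp_apply]
    rw [← mul_div_assoc, Finset.mul_sum, Finset.sum_div]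
    refine (norm_sum_le _ _).trans ((Finset.sum_le_sum fun j hj => ?_).trans
      (Finset.sum_le_sum_of_subset_of_nonneg hsub2 fun j _ _ => by positivity))
    simp only [Set.Finite.mem_toFinset, Set.mem_ofPred_eq, Finset.mem_sdiff, not_le] at hj
    rw [Real.norm_eq_abs, abs_div, div_le_div_iff₀ (by linarith) (by linarith)]
    nlinarith [abs_nonneg (a j), hj.2]
  simpa using h2.add h1

/-! ### The Cauchy limit law -/

section Cauchy

variable {Ω ι : Type*} [MeasurableSpace Ω] {x ξ : ι → Ω → ℝ} {ν : Measure ℝ} {P : Measure Ω}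
  [IsProbabilityMeasure P] [IsProbabilityMeasure ν] [Countable ι] {c : ℝ≥0}

/-- The sums of the marks over annuli grow more slowly than the radii. -/
theorem ae_tendsto_tsum_annulus_div (hP : IsPoissonProcess x (c • (volume : Measure ℝ)) P)
    (hξ : ∀ j, Measurable (ξ j)) (hν : ∀ j, P.map (ξ j) = ν) (hi : iIndepFun ξ P)
    (hxξ : IndepFun (fun ω j => ξ j ω) (fun ω j => x j ω) P)
    (hint : Integrable (fun m : ℝ => m) ν) :
    ∀ᵐ ω ∂P, Tendsto (fun n : ℕ =>
      (∑' j, (annulus (n + 1)).indicator (fun _ => |ξ j ω|) (x j ω)) / (n + 1)) atTop (𝓝 0) := by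
  -- The shift discards the null annulus `0`; all the others have length 2, so the sums `Z n` are
  -- identically distributed.
  let w : ℕ → ℝ × ℝ → ℝ := fun n p => (annulus (n + 1)).indicator (fun _ => |p.2|) p.1
  let Z : ℕ → Ω → ℝ := fun n ω => ∑' j, w n (x j ω, ξ j ω)
  have hμ : ∀ n, (c • (volume : Measure ℝ)) (annulus n) ≠ ∞ := fun n =>
    ENNReal.mul_ne_top ENNReal.coe_ne_top (volume_annulus_ne_top n)
  have hw : ∀ n, Measurable (w n) := fun n => by
    have : w n = (Prod.fst ⁻¹' annulus (n + 1)).indicator fun p => |p.2| := rfl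
    rw [this]
    exact Measurable.indicator (by fun_prop) (measurable_fst (measurableSet_annulus _))
  have hwA : ∀ n, ∀ y ∉ annulus (n + 1), ∀ m, w n (y, m) = 0 := fun n y hy m =>
    Set.indicator_of_notMem hy _
  have hZm : ∀ n, Measurable (Z n) := fun n =>
    Measurable.tsum fun j => (hw n).comp ((hP.measurable j).prodMk (hξ j))
  have hZi : iIndepFun Z P := hP.iIndepFun_tsum hξ hν hi hxξ
    (fun n => measurableSet_annulus (n + 1)) (fun n => hμ (n + 1))
    (fun _ _ h => pairwise_disjoint_annulus (by simpa using h)) hw hwA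
  have hchar : ∀ n t, charFun (P.map (Z n)) t = Complex.exp (c * 2 *
      (∫ m, Complex.exp ((t * |m| : ℝ) * Complex.I) ∂ν - 1)) := fun n t => by
    rw [hP.charFun_tsum hξ hν hi hxξ (measurableSet_annulus (n + 1)) (hμ (n + 1)) (hw n) (hwA n)]
    rw [setIntegral_congr_fun (g := fun _ =>
      (∫ m, Complex.exp ((t * |m| : ℝ) * Complex.I) ∂ν - 1)) (measurableSet_annulus (n + 1)),
      setIntegral_const, Complex.real_smul]
    · congr 2
      rw [measureReal_nnreal_smul_apply, Measure.real, volume_annulus_succ]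
      push_cast
      rfl
    · intro y hy
      simp [w, Set.indicator_of_mem hy]
  have hid : ∀ n, IdentDistrib (Z n) (Z 0) P P := fun n => by
    refine ⟨(hZm n).aemeasurable, (hZm 0).aemeasurable, ?_⟩
    have := Measure.isProbabilityMeasure_map (μ := P) (hZm n).aemeasurable
    have := Measure.isProbabilityMeasure_map (μ := P) (hZm 0).aemeasurable
    exact Measure.ext_of_charFun (funext fun t => by rw [hchar, hchar])
  have hZint : Integrable (Z 0) P := by
    refine ⟨(hZm 0).aestronglyMeasurable, lt_of_le_of_lt (lintegral_mono fun ω =>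
      enorm_tsum_le_tsum_enorm) ?_⟩
    have := hP.lintegral_tsum_marks_ne_top hξ hν hxξ (measurableSet_annulus 1) (hμ 1)
      (f := fun m => ‖m‖ₑ) (by fun_prop) hint.hasFiniteIntegral.ne
    refine lt_of_eq_of_lt (lintegral_congr fun ω => tsum_congr fun j => ?_) this.lt_top
    by_cases h : x j ω ∈ annulus 1
    · simp [w, h]
    · simp [w, h]
  filter_upwards [strong_law_ae_real Z hZint (fun i j h => hZi.indepFun h) hid] with ω hω
  -- Subtracting `n / (n + 1)` times the `n`-th average from the next average leaves `Z n / (n +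
  -- 1)`, which therefore tends to 0.
  have h1 := (tendsto_add_atTop_iff_nat 1).2 hω
  have h2 := h1.sub (hω.mul (tendsto_natCast_div_add_atTop (1 : ℝ)))
  rw [mul_one, sub_self] at h2
  refine h2.congr fun n => ?_
  rw [Finset.sum_range_succ]
  have hn : (n : ℝ) + 1 ≠ 0 := by positivity
  rcases eq_or_ne n 0 with rfl | hn0
  · simp [Z, w]
  · have hn0' : (n : ℝ) ≠ 0 := by exact_mod_cast hn0
    push_cast
    field_simp
    simp [Z, w]

/-- The principal value sum over a marked Poisson process has a Cauchy distribution. -/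
theorem exists_hasPrincipalValueSum_hasCauchyDistribution (hc : 0 < c)
    (hP : IsPoissonProcess x (c • (volume : Measure ℝ)) P)
    (hξ : ∀ j, Measurable (ξ j)) (hν : ∀ j, P.map (ξ j) = ν) (hi : iIndepFun ξ P)
    (hxξ : IndepFun (fun ω j => ξ j ω) (fun ω j => x j ω) P)
    (hint : Integrable (fun m : ℝ => m) ν) (hν0 : 0 < ∫ m, |m| ∂ν) :
    ∃ S : Ω → ℝ,
      (∀ᵐ ω ∂P, HasPrincipalValueSum (fun j => ξ j ω) (fun j => x j ω) (S ω)) ∧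
        HasCauchyDistribution S P := by
  let w : ℕ → ℝ × ℝ → ℝ := fun k p => (annulus k).indicator (fun _ => p.2 / p.1) p.1
  let Y : ℕ → Ω → ℝ := fun k ω => ∑' j, w k (x j ω, ξ j ω)
  have hμ : ∀ n, (c • (volume : Measure ℝ)) (annulus n) ≠ ∞ := fun n =>
    ENNReal.mul_ne_top ENNReal.coe_ne_top (volume_annulus_ne_top n)
  have hw : ∀ n, Measurable (w n) := fun n => by
    have : w n = (Prod.fst ⁻¹' annulus n).indicator fun p => p.2 / p.1 := rfl
    rw [this]
    exact Measurable.indicator (by fun_prop) (measurable_fst (measurableSet_annulus _))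
  have hwA : ∀ n, ∀ y ∉ annulus n, ∀ m, w n (y, m) = 0 := fun n y hy m =>
    Set.indicator_of_notMem hy _
  have hYm : ∀ n, Measurable (Y n) := fun n =>
    Measurable.tsum fun j => (hw n).comp ((hP.measurable j).prodMk (hξ j))
  have hYi : iIndepFun Y P := hP.iIndepFun_tsum hξ hν hi hxξ
    measurableSet_annulus hμ pairwise_disjoint_annulus hw hwA
  let K : ℝ := (∫ m, |m| ∂ν) * ∫ u : ℝ, (1 - Real.cos u⁻¹)
  have hK : 0 < K := mul_pos hν0 integral_one_sub_cos_inv_pos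
  let γ : ℝ≥0 := c * K.toNNReal
  have hγ : 0 < γ := mul_pos hc (Real.toNNReal_pos.2 hK)
  have hchar : ∀ t, Tendsto (fun n => ∏ k ∈ Finset.range n, charFun (P.map (Y k)) t) atTop
      (𝓝 (charFun (cauchyMeasure 0 γ) t)) := by
    intro t
    -- The annuli `0, …, n` fill exactly `|u| ≤ n`, hence the shift by one.
    rw [← tendsto_add_atTop_iff_nat 1, charFun_cauchyMeasure hγ]
    have h1 : ∀ k, charFun (P.map (Y k)) t = Complex.exp (∫ y in annulus k,
        (∫ m, Complex.exp ((t * (m / y) : ℝ) * Complex.I) ∂ν - 1) ∂(c • (volume : Measure ℝ))) := by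
      intro k
      rw [hP.charFun_tsum hξ hν hi hxξ (measurableSet_annulus k) (hμ k) (hw k) (hwA k)]
      congr 1
      refine setIntegral_congr_fun (measurableSet_annulus k) fun y hy => ?_
      simp [w, Set.indicator_of_mem hy]
    have hm : StronglyMeasurable fun p : ℝ × ℝ => Complex.exp ((t * (p.2 / p.1) : ℝ) * Complex.I) :=
      Measurable.stronglyMeasurable (by fun_prop)
    have hD : ∀ k, IntegrableOn (fun y : ℝ =>
        ∫ m, Complex.exp ((t * (m / y) : ℝ) * Complex.I) ∂ν - 1) (annulus k)
        (c • (volume : Measure ℝ)) := fun k => by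
      refine Measure.integrableOn_of_bounded (M := 2) (hμ k)
        ((hm.integral_prod_right' (ν := ν)).measurable.sub_const 1).aestronglyMeasurable
        (ae_of_all _ fun y => (norm_sub_le _ _).trans ?_)
      have : ‖∫ m, Complex.exp ((t * (m / y) : ℝ) * Complex.I) ∂ν‖ ≤ 1 := by
        simpa using norm_integral_le_of_norm_le_const (μ := ν) (C := 1)
          (ae_of_all _ fun m => (Complex.norm_exp_ofReal_mul_I (t * (m / y))).le)
      rw [norm_one]
      linarith
    have h2 : ∀ n : ℕ, ∏ k ∈ Finset.range (n + 1), charFun (P.map (Y k)) t =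
        Complex.exp (c * ∫ y in {u : ℝ | |u| ≤ n},
          (∫ m, Complex.exp ((t * (m / y) : ℝ) * Complex.I) ∂ν - 1)) := by
      intro n
      simp_rw [h1]
      rw [← Complex.exp_sum, ← integral_biUnion_finset _ (fun k _ => measurableSet_annulus k)
        (pairwise_disjoint_annulus.set_pairwise _) (fun k _ => hD k), biUnion_annulus,
        Measure.restrict_smul, integral_smul_nnreal_measure]
      rfl
    simp_rw [h2]
    have h3 := ((tendsto_integral_charFun_div hint t).const_mul (c : ℂ)).cexp
    convert h3 using 3
    have : (γ : ℝ) = c * K := by simp [γ, hK.le]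
    rw [this]
    simp only [K]
    push_cast
    ring
  have hsum : ∀ n, charFun (P.map fun ω => ∑ k ∈ Finset.range n, Y k ω) =
      fun t => ∏ k ∈ Finset.range n, charFun (P.map (Y k)) t := fun n => by
    rw [iIndepFun.charFun_map_fun_finsetSum_eq_prod (fun k _ => (hYm k).aemeasurable)
      (iIndepFun_iff_finset.1 hYi _)]
    ext t
    simp
  have hconv := ae_exists_tendsto_sum_of_charFun hYm hYi fun t =>
    ⟨_, by rw [charFun_cauchyMeasure hγ]; exact Complex.exp_ne_zero _, hchar t⟩
  let S : Ω → ℝ := fun ω => limUnder atTop fun n => ∑ k ∈ Finset.range n, Y k ω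
  have hS : ∀ᵐ ω ∂P, Tendsto (fun n => ∑ k ∈ Finset.range n, Y k ω) atTop (𝓝 (S ω)) := by
    filter_upwards [hconv] with ω hω
    exact tendsto_nhds_limUnder hω
  refine ⟨S, ?_, γ, hγ, hasLaw_of_tendsto_charFun
    (fun n => Finset.measurable_fun_sum _ fun k _ => hYm k) hS fun t => ?_⟩
  · have h0 := hP.ae_notMem (A := {0}) (measurableSet_singleton 0) (by simp)
    have hfin : ∀ᵐ ω ∂P, ∀ k, {j | x j ω ∈ annulus k}.Finite :=
      ae_all_iff.2 fun k => hP.ae_finite (measurableSet_annulus k) (hμ k)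
    filter_upwards [hS, h0, hfin, ae_tendsto_tsum_annulus_div hP hξ hν hi hxξ hint]
      with ω h1 h2 h3 h4
    exact hasPrincipalValueSum_of_tendsto h2 h3 h1 h4
  · simp_rw [hsum]
    exact hchar t

end Cauchy

theorem mainTheorem11 {Ω : Type*} [MeasurableSpace Ω] (P : Measure Ω) [IsProbabilityMeasure P]
    {ι : Type*} [Countable ι] (c : ℝ≥0) (hc : 0 < c) (x : ι → Ω → ℝ)
    (hx : IsPoissonProcess x (c • (volume : Measure ℝ)) P) :
    (∃ S : Ω → ℝ,
      (∀ᵐ ω ∂P, HasPrincipalValueSum (fun _ => 1) (fun j => x j ω) (S ω)) ∧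
        HasCauchyDistribution S P) ∧
    (∀ ξ : ι → Ω → ℝ,
      (∀ j, Measurable (ξ j)) →
      (∀ j, Integrable (ξ j) P) →
      (∀ i j, IdentDistrib (ξ i) (ξ j) P P) →
      (∀ j, ¬ (ξ j =ᵐ[P] 0)) →
      iIndepFun ξ P →
      IndepFun (fun ω j => ξ j ω) (fun ω j => x j ω) P →
      ∃ S : Ω → ℝ,
        (∀ᵐ ω ∂P, HasPrincipalValueSum (fun j => ξ j ω) (fun j => x j ω) (S ω)) ∧
          HasCauchyDistribution S P) := by
  constructor
  · have h1 : iIndepFun (fun (_ : ι) (_ : Ω) => (1 : ℝ)) P := by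
      refine iIndepFun_iff_measure_inter_preimage_eq_mul.2 fun s B _ => ?_
      by_cases h : ∀ i ∈ s, (1 : ℝ) ∈ B i
      · have h1 : ∀ i ∈ s, (fun _ : Ω => (1 : ℝ)) ⁻¹' B i = Set.univ := fun i hi => by
          simp [h i hi]
        rw [Set.iInter₂_congr h1, Finset.prod_congr rfl fun i hi => by rw [h1 i hi]]
        simp
      · push Not at h
        obtain ⟨i, hi, hB⟩ := h
        have h1 : (fun _ : Ω => (1 : ℝ)) ⁻¹' B i = ∅ := by simp [hB]
        rw [Finset.prod_eq_zero hi (by rw [h1, measure_empty])]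
        exact measure_mono_null (Set.biInter_subset_of_mem hi) (by rw [h1, measure_empty])
    refine exists_hasPrincipalValueSum_hasCauchyDistribution (ξ := fun _ _ => 1)
      (ν := Measure.dirac 1) hc hx (fun _ => measurable_const) (fun _ => by simp) h1
      (indepFun_const_left _ _) (integrable_dirac (by simp)) (by simp)
  · intro ξ hξ hint hid h0 hi hxξ
    -- An index is needed to name the common law of the marks; the positive intensity of annulus `1`
    -- supplies it.
    obtain ⟨j₀⟩ : Nonempty ι := hx.nonempty (A := annulus 1) (measurableSet_annulus 1)
      (by simp [volume_annulus_succ 0, hc.ne'])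
      (ENNReal.mul_ne_top ENNReal.coe_ne_top (volume_annulus_ne_top 1))
    have := Measure.isProbabilityMeasure_map (μ := P) (hξ j₀).aemeasurable
    refine exists_hasPrincipalValueSum_hasCauchyDistribution (ν := P.map (ξ j₀)) hc hx hξ
      (fun j => (hid j j₀).map_eq) hi hxξ ?_ ?_
    · exact (integrable_map_measure (by fun_prop) (hξ j₀).aemeasurable).2 (hint j₀)
    · rw [integral_map (hξ j₀).aemeasurable (by fun_prop)]
      refine lt_of_le_of_ne (integral_nonneg fun _ => abs_nonneg _) fun h => h0 j₀ ?_
      have := (integral_eq_zero_iff_of_nonneg (fun _ => abs_nonneg _) (hint j₀).abs).1 h.symm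
      filter_upwards [this] with ω hω
      simpa using hω
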